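/- Let $X$ be a separable Banach space over $\mathbb{R}$ or $\mathbb{C}$ whose dual $X^*$ is non-separable in the norm topology. Then for every $\delta>0$ there is a closed linear subspace $Y\subseteq X$ such that the dual $(X/Y)^*$ of the quotient Banach space $X/Y$ is non-separable in the norm topology and $X/Y$ has a (Schauder) basis with basis constant not exceeding $1+\delta$. Here the basis constant of a basis $(e_n)_{n\ge 0}$ with coordinate functionals $(e_n^*)_{n\ge 0}$ is $\sup_{n}\|P_n\|$, where $P_n x=\sum_{i<n}e_i^*(x)\,e_i$. -/

import Mathlib

open Topology Filter Metric TopologicalSpace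

/-! Non-separability of `X*` gives a bounded set `K` in which every `f` is weak* approximated by
members of `K` at distance more than `ε`. Such a difference `f' - f` can be perturbed in norm to
vanish on a given finite-dimensional space (`exists_perturbed_difference`). Iterating along an
infinitely branching tree gives edge labels `g n`, each zero on a finite-dimensional `E n` but
larger than `ε` at a point of the unit ball in `E (n + 1)`. Let `Y` be the common kernel of the `g
n`. Path sums nearly telescope to differences in `K`, so they are bounded. Weak* cluster points
along the uncountably many branches annihilate `Y` and are `ε`-separated. The `E n` also almost
isometrically lift the quotient by `g 0, ..., g (n - 1)`. Hence the image of `E n` in `X ⧸ Y` is the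
range of a projection of norm at most `1 + δ`; these are the partial-sum projections of a basis. -/

/-! ### Separated sets and condensation points -/

theorem exists_uncountable_bounded_separated {W : Type*} [NormedAddCommGroup W]
    (hW : ¬ SeparableSpace W) :
    ∃ ε > 0, ∃ R : ℝ, ∃ A : Set W, ¬ A.Countable ∧ (∀ a ∈ A, ‖a‖ ≤ R) ∧
      A.Pairwise fun a b => ε < ‖a - b‖ := by
  obtain ⟨ε, hε, hnet⟩ : ∃ ε > 0, ∀ s : Set W, s.Countable → ∃ x, ∀ y ∈ s, ε < dist x y := by
    by_contra! H
    exact hW (@SecondCountableTopology.to_separableSpace W _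
      (Metric.secondCountable_of_almost_dense_set fun ε hε => H ε hε))
  -- A maximal `ε`-separated set is an `ε`-net, so it cannot be countable.
  obtain ⟨S, hS⟩ := zorn_subset {S : Set W | S.Pairwise fun a b => ε < ‖a - b‖} (by
    intro c hc hchain
    refine ⟨⋃₀ c, ?_, fun s hs => Set.subset_sUnion_of_mem hs⟩
    exact (Set.pairwise_sUnion hchain.directedOn).2 fun s hs => hc hs)
  have hSunc : ¬ S.Countable := by
    intro hc
    obtain ⟨x, hx⟩ := hnet S hc
    have hins : insert x S ∈ {S : Set W | S.Pairwise fun a b => ε < ‖a - b‖} := by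
      refine hS.prop.insert fun y hy _ => ?_
      have := hx y hy
      rw [dist_eq_norm] at this
      exact ⟨this, by rwa [norm_sub_rev]⟩
    have hxS : x ∈ S := hS.le_of_ge hins (Set.subset_insert x S) (Set.mem_insert x S)
    have := hx x hxS
    rw [dist_self] at this
    exact absurd this hε.not_gt
  obtain ⟨n, hn⟩ : ∃ n : ℕ, ¬ (S ∩ {a | ‖a‖ ≤ n}).Countable := by
    by_contra! H
    refine hSunc ((Set.countable_iUnion H).mono fun a ha => ?_)
    obtain ⟨n, hn⟩ := exists_nat_ge ‖a‖
    exact Set.mem_iUnion.2 ⟨n, ha, hn⟩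
  exact ⟨ε, hε, n, _, hn, fun a ha => ha.2, hS.prop.mono Set.inter_subset_left⟩

theorem countable_setOf_not_condensation {W Z : Type*} [TopologicalSpace Z]
    [SecondCountableTopology Z] (φ : W → Z) (A : Set W) :
    {a ∈ A | ∃ U ∈ 𝓝 (φ a), (A ∩ φ ⁻¹' U).Countable}.Countable := by
  set B := {a ∈ A | ∃ U ∈ 𝓝 (φ a), (A ∩ φ ⁻¹' U).Countable}
  have hU : ∀ z ∈ φ '' B, ∃ U ∈ 𝓝 z, (A ∩ φ ⁻¹' U).Countable := by
    rintro _ ⟨a, ha, rfl⟩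
    exact ha.2
  choose! U hUn hUc using hU
  obtain ⟨t, htB, htc, ht⟩ := countable_cover_nhdsWithin (f := U) (s := φ '' B)
    fun z hz => mem_nhdsWithin_of_mem_nhds (hUn z hz)
  refine (htc.biUnion fun z hz => hUc z (htB hz)).mono fun a ha => ?_
  obtain ⟨z, hz, haz⟩ := Set.mem_iUnion₂.1 (ht (Set.mem_image_of_mem φ ha))
  exact Set.mem_iUnion₂.2 ⟨z, hz, ha.1, haz⟩

/-! ### Weak*-small, norm-large differences and finite-dimensional lifts -/

section DualSpace

variable {𝕜 : Type*} [RCLike 𝕜] {X : Type*} [NormedAddCommGroup X] [NormedSpace 𝕜 X]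

theorem exists_bounded_weakStar_norm_separated [SeparableSpace X]
    (hX : ¬ SeparableSpace (StrongDual 𝕜 X)) :
    ∃ ε > 0, ∃ R : ℝ, ∃ K : Set (StrongDual 𝕜 X), K.Nonempty ∧ (∀ f ∈ K, ‖f‖ ≤ R) ∧
      ∀ f ∈ K, ∀ F : Set X, F.Finite → ∀ η > 0, ∃ f' ∈ K, ε < ‖f' - f‖ ∧
        ∀ x ∈ F, ‖(f' - f) x‖ ≤ η := by
  obtain ⟨ε, hε, R, A, hA, hR, hsep⟩ := exists_uncountable_bounded_separated hX
  let d := denseSeq X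
  let φ : StrongDual 𝕜 X → ℕ → 𝕜 := fun f n => f (d n)
  set B := {a ∈ A | ∃ U ∈ 𝓝 (φ a), (A ∩ φ ⁻¹' U).Countable} with hB
  have hBc : B.Countable := countable_setOf_not_condensation φ A
  refine ⟨ε, hε, R, A \ B, ?_, fun f hf => hR f hf.1, ?_⟩
  · by_contra hne
    rw [Set.not_nonempty_iff_eq_empty, Set.sdiff_eq_empty] at hne
    exact hA (hBc.mono hne)
  intro f hf F hF η hη
  have hR0 : 0 ≤ R := (norm_nonneg _).trans (hR f hf.1)
  -- As `‖f' - f‖ ≤ 2 * (R + 1)`, replacing `x` by `d j` costs at most `η / 2`.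
  have hclose : ∀ x : X, ∃ j, ‖x - d j‖ ≤ η / (4 * (R + 1)) := fun x => by
    obtain ⟨j, hj⟩ := (denseRange_denseSeq X).exists_dist_lt x
      (show 0 < η / (4 * (R + 1)) by positivity)
    exact ⟨j, by rw [← dist_eq_norm]; exact hj.le⟩
  choose j hj using hclose
  let U : Set (ℕ → 𝕜) := {u | ∀ x ∈ F, ‖u (j x) - f (d (j x))‖ < η / 2}
  have hU : U ∈ 𝓝 (φ f) := by
    refine (Filter.eventually_all_finite hF).2 fun x _ => ?_
    have hc : Continuous fun u : ℕ → 𝕜 => ‖u (j x) - f (d (j x))‖ := by fun_prop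
    exact hc.continuousAt.eventually (gt_mem_nhds (by simpa [φ] using half_pos hη))
  have hunc : ¬ (A ∩ φ ⁻¹' U).Countable := fun h => hf.2 ⟨hf.1, U, hU, h⟩
  obtain ⟨f', ⟨hf'A, hf'U⟩, hf'⟩ : ∃ f' ∈ A ∩ φ ⁻¹' U, f' ∉ insert f B := by
    by_contra! H
    exact hunc ((hBc.insert f).mono H)
  rw [Set.mem_insert_iff, not_or] at hf'
  refine ⟨f', ⟨hf'A, hf'.2⟩, hsep hf'A hf.1 hf'.1, fun x hx => ?_⟩
  have h1 : (f' - f) x = (f' - f) (x - d (j x)) + (f' (d (j x)) - f (d (j x))) := by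
    simp only [map_sub, sub_apply]; ring
  have h2 : ‖f' - f‖ ≤ 2 * (R + 1) := by
    have := norm_sub_le f' f
    linarith [hR f' hf'A, hR f hf.1]
  calc ‖(f' - f) x‖ ≤ ‖(f' - f) (x - d (j x))‖ + ‖f' (d (j x)) - f (d (j x))‖ := by
        rw [h1]; exact norm_add_le _ _
    _ ≤ 2 * (R + 1) * (η / (4 * (R + 1))) + η / 2 :=
        add_le_add (((f' - f).le_opNorm _).trans
          (mul_le_mul h2 (hj x) (norm_nonneg _) (by positivity))) (hf'U x hx).le
    _ = η := by field_simp; ring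

theorem exists_perturbed_difference [SeparableSpace X]
    (hX : ¬ SeparableSpace (StrongDual 𝕜 X)) :
    ∃ ε > 0, ∃ R : ℝ, ∃ K : Set (StrongDual 𝕜 X), K.Nonempty ∧ (∀ f ∈ K, ‖f‖ ≤ R) ∧
      ∀ f ∈ K, ∀ E : Submodule 𝕜 X, FiniteDimensional 𝕜 E → ∀ η > 0,
        ∃ f' ∈ K, ∃ g : StrongDual 𝕜 X, ∃ x : X, (∀ y ∈ E, g y = 0) ∧
          ‖g - (f' - f)‖ ≤ η ∧ ‖x‖ ≤ 1 ∧ ε < ‖g x‖ := by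
  obtain ⟨ε, hε, R, K, hK, hR, h⟩ := exists_bounded_weakStar_norm_separated hX
  refine ⟨ε / 2, half_pos hε, R, K, hK, hR, fun f hf E _ η hη => ?_⟩
  let b := Module.finBasis 𝕜 E
  obtain ⟨C, hC, hCb⟩ := b.exists_opNorm_le (F := 𝕜)
  set η' := min η (ε / 2) with hη'
  have hη'0 : 0 < η' := lt_min hη (half_pos hε)
  obtain ⟨f', hf', hfar, hclose⟩ := h f hf (Set.range fun i => (b i : X)) (Set.finite_range _)
    (η' / C) (div_pos hη'0 hC)
  -- The difference is small on a basis of `E`, hence small in norm on `E`; subtracting a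
  -- Hahn–Banach extension `k` of its restriction makes it vanish there.
  obtain ⟨k, hk, hknorm⟩ := exists_extension_norm_eq E ((f' - f).comp E.subtypeL)
  have hkη : ‖k‖ ≤ η' := by
    rw [hknorm]
    refine (hCb (div_pos hη'0 hC).le fun i => ?_).trans_eq (by field_simp)
    exact hclose _ ⟨i, rfl⟩
  have hg : ε / 2 < ‖f' - f - k‖ := by
    have := norm_sub_norm_le (f' - f) k
    have := min_le_right η (ε / 2)
    linarith
  obtain ⟨x, hx1, hx⟩ := (f' - f - k).exists_lt_apply_of_lt_opNorm hg
  refine ⟨f', hf', f' - f - k, x, fun y hy => ?_, ?_, hx1.le, hx⟩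
  · have := hk ⟨y, hy⟩
    simp only [ContinuousLinearMap.comp_apply, Submodule.subtypeL_apply] at this
    rw [sub_apply, this, sub_self]
  · rw [sub_sub_cancel_left, norm_neg]
    exact hkη.trans (min_le_left _ _)

/-- The unit ball of the quotient by the common kernel is compact, and the images of the open
`C`-balls of finite-dimensional subspaces form a directed cover of it. -/
theorem exists_finiteDimensional_almost_isometric_lift (s : Finset (StrongDual 𝕜 X)) {C : ℝ}
    (hC : 1 < C) :
    ∃ E : Submodule 𝕜 X, FiniteDimensional 𝕜 E ∧
      ∀ x, ∃ y ∈ E, (∀ g ∈ s, g y = g x) ∧ ‖y‖ ≤ C * ‖x‖ := by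
  let T : X →L[𝕜] (s → 𝕜) := ContinuousLinearMap.pi fun g => g.1
  let N : Submodule 𝕜 X := T.ker
  have hNc : IsClosed (N : Set X) := T.isClosed_ker
  have hfd : FiniteDimensional 𝕜 (X ⧸ N) :=
    (T.toLinearMap.quotKerEquivRange).symm.finiteDimensional
  have : ProperSpace (X ⧸ N) := FiniteDimensional.proper_rclike 𝕜 _
  -- Any `E ≥ E₀` maps onto `X ⧸ N`, which makes the image of its ball open.
  obtain ⟨E₀, hE₀⟩ := N.exists_isCompl
  have hE₀fd : FiniteDimensional 𝕜 E₀ :=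
    (Submodule.quotientEquivOfIsCompl N E₀ hE₀).finiteDimensional
  let ι := {E : Submodule 𝕜 X // FiniteDimensional 𝕜 E ∧ E₀ ≤ E}
  let U : ι → Set (X ⧸ N) := fun E => N.mkQ '' {y | y ∈ E.1 ∧ ‖y‖ < C}
  have hUo : ∀ E, IsOpen (U E) := by
    rintro ⟨E, hE, hE₀E⟩
    have hsurj : Function.Surjective (N.mkQ ∘ₗ E.subtype) := by
      intro q
      obtain ⟨x, rfl⟩ := N.mkQ_surjective q
      obtain ⟨a, ha, b, hb, rfl⟩ := Submodule.mem_sup.1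
        (hE₀.sup_eq_top ▸ Submodule.mem_top : x ∈ N ⊔ E₀)
      refine ⟨⟨b, hE₀E hb⟩, ?_⟩
      simp [(Submodule.Quotient.mk_eq_zero N).2 ha]
    have := (N.mkQ ∘ₗ E.subtype).isOpenMap_of_finiteDimensional hsurj _
      (isOpen_lt (continuous_norm (E := E)) (continuous_const (y := C)))
    convert this using 1
    ext q
    simp [U, and_assoc, and_left_comm]
  have hdir : Directed (· ⊆ ·) U := by
    rintro ⟨E, hE, hE'⟩ ⟨F, hF, hF'⟩
    refine ⟨⟨E ⊔ F, inferInstance, hE'.trans le_sup_left⟩, ?_, ?_⟩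
    · exact Set.image_mono fun y hy => ⟨(le_sup_left : E ≤ E ⊔ F) hy.1, hy.2⟩
    · exact Set.image_mono fun y hy => ⟨(le_sup_right : F ≤ E ⊔ F) hy.1, hy.2⟩
  have : Nonempty ι := ⟨⟨E₀, hE₀fd, le_rfl⟩⟩
  obtain ⟨⟨E, hE, _⟩, hEU⟩ := (isCompact_closedBall (0 : X ⧸ N) 1).elim_directed_cover U hUo
    (fun q hq => by
      obtain ⟨y, rfl, hy⟩ := Submodule.Quotient.norm_mk_lt q (ε := C - 1) (by linarith)
      rw [mem_closedBall_zero_iff] at hq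
      refine Set.mem_iUnion.2 ⟨⟨E₀ ⊔ Submodule.span 𝕜 {y}, inferInstance, le_sup_left⟩, y,
        ⟨(le_sup_right : _ ≤ E₀ ⊔ Submodule.span 𝕜 {y}) (Submodule.mem_span_singleton_self y),
          by linarith⟩, rfl⟩) hdir
  have key : ∀ x : X, ‖x‖ ≤ 1 → ∃ y ∈ E, (∀ g ∈ s, g y = g x) ∧ ‖y‖ ≤ C := by
    intro x hx
    obtain ⟨y, ⟨hyE, hy⟩, hyx⟩ := hEU (mem_closedBall_zero_iff.2
      ((Submodule.Quotient.norm_mk_le N x).trans hx))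
    refine ⟨y, hyE, fun g hg => ?_, hy.le⟩
    have : y - x ∈ N := (Submodule.Quotient.eq N).1 hyx
    have := congrFun (show T (y - x) = 0 from this) ⟨g, hg⟩
    simpa [T, sub_eq_zero] using this
  refine ⟨E, hE, fun x => ?_⟩
  rcases eq_or_ne x 0 with rfl | hx
  · exact ⟨0, E.zero_mem, by simp, by simp⟩
  have hx' : (‖x‖ : 𝕜) ≠ 0 := by simpa using hx
  obtain ⟨y, hyE, hy, hyC⟩ := key ((‖x‖ : 𝕜)⁻¹ • x) (by
    rw [norm_smul, norm_inv, RCLike.norm_ofReal, abs_norm, inv_mul_cancel₀ (by simpa using hx)])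
  refine ⟨(‖x‖ : 𝕜) • y, E.smul_mem _ hyE, fun g hg => ?_, ?_⟩
  · rw [map_smul, hy g hg, map_smul, smul_smul, mul_inv_cancel₀ hx', one_smul]
  · rw [norm_smul, RCLike.norm_ofReal, abs_norm, mul_comm]
    gcongr

end DualSpace

/-! ### From lifts to a basis -/

/-- On `F n` all `g i` with `i ≥ n` vanish, so a vector of `F n` is determined by the values of `g
i`, `i < n`. The lift is therefore unique, hence linear: it is the projection `P n`. -/
theorem exists_schauderBasis_of_almost_isometric_lift {𝕜 : Type*} [RCLike 𝕜] {V : Type*}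
    [NormedAddCommGroup V] [NormedSpace 𝕜 V] (g : ℕ → StrongDual 𝕜 V) (F : ℕ → Submodule 𝕜 V)
    (hF : Monotone F) [∀ n, FiniteDimensional 𝕜 (F n)]
    (hg0 : ∀ n, ∀ v ∈ F n, g n v = 0) (hg1 : ∀ n, ∃ v ∈ F (n + 1), g n v ≠ 0)
    (hsep : ∀ v, (∀ n, g n v = 0) → v = 0) {C : ℝ} (hC : 0 ≤ C)
    (hlift : ∀ n v, ∃ w ∈ F n, (∀ i < n, g i w = g i v) ∧ ‖w‖ ≤ C * ‖v‖)
    (hdense : Dense (⋃ n, (F n : Set V))) :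
    ∃ b : SchauderBasis 𝕜 V, b.enormProjBound ≤ ENNReal.ofReal C := by
  have huniq : ∀ n, ∀ v ∈ F n, ∀ w ∈ F n, (∀ i < n, g i v = g i w) → v = w := by
    intro n v hv w hw h
    refine sub_eq_zero.1 (hsep _ fun i => ?_)
    rw [map_sub, sub_eq_zero]
    rcases lt_or_ge i n with hi | hi
    · exact h i hi
    · rw [hg0 i v (hF hi hv), hg0 i w (hF hi hw)]
  choose p hpF hpg hpC using hlift
  let P : ℕ → V →L[𝕜] V := fun n => LinearMap.mkContinuous
    { toFun := p n
      map_add' := fun v w => huniq n _ (hpF n _) _ (add_mem (hpF n _) (hpF n _)) fun i hi => by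
        simp [hpg n _ i hi]
      map_smul' := fun c v => huniq n _ (hpF n _) _ (Submodule.smul_mem _ _ (hpF n _))
        fun i hi => by simp [hpg n _ i hi] } C (hpC n)
  have hPF : ∀ n v, P n v ∈ F n := hpF
  have hPg : ∀ n v, ∀ i < n, g i (P n v) = g i v := hpg
  have hPC : ∀ n v, ‖P n v‖ ≤ C * ‖v‖ := hpC
  have hPid : ∀ n, ∀ v ∈ F n, P n v = v := fun n v hv => huniq n _ (hPF n v) _ hv (hPg n v)
  have hrange : ∀ n, (P n).toLinearMap.range = F n := fun n => by
    refine le_antisymm ?_ fun v hv => ⟨v, hPid n v hv⟩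
    rintro _ ⟨v, rfl⟩
    exact hPF n v
  have hcomp : ∀ n m v, P n (P m v) = P (min n m) v := by
    intro n m v
    rcases le_total n m with h | h
    · rw [min_eq_left h]
      exact huniq n _ (hPF n _) _ (hPF n _) fun i hi => by
        rw [hPg n _ i hi, hPg m _ i (hi.trans_le h), hPg n _ i hi]
    · rw [min_eq_right h]
      exact hPid n _ (hF h (hPF m v))
  have hF0 : F 0 = ⊥ := (Submodule.eq_bot_iff _).2 fun v hv =>
    huniq 0 v hv 0 (F 0).zero_mem fun i hi => absurd hi (Nat.not_lt_zero i)
  have hrank : ∀ n, Module.finrank 𝕜 (F n) = n := by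
    intro n
    induction n with
    | zero => rw [hF0, finrank_bot]
    | succ n ih =>
      let k : Module.Dual 𝕜 (F (n + 1)) := (g n).toLinearMap ∘ₗ (F (n + 1)).subtype
      have hk : k ≠ 0 := by
        obtain ⟨v, hv, hgv⟩ := hg1 n
        exact fun h => hgv (LinearMap.congr_fun h ⟨v, hv⟩)
      -- `F n` is the kernel of `g n` on `F (n + 1)`, so dimensions grow by exactly one.
      have hker : (LinearMap.ker k).map (F (n + 1)).subtype = F n := by
        refine le_antisymm ?_ fun v hv => ⟨⟨v, hF n.le_succ hv⟩, hg0 n v hv, rfl⟩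
        rintro _ ⟨⟨v, hv⟩, hkv, rfl⟩
        have hkv : g n v = 0 := hkv
        have : P n v = v := huniq (n + 1) _ (hF n.le_succ (hPF n v)) _ hv fun i hi => by
          rcases (Nat.lt_succ_iff_lt_or_eq).1 hi with hi | rfl
          · exact hPg n v i hi
          · rw [hkv, hg0 i _ (hPF i v)]
        exact Set.mem_of_eq_of_mem this.symm (hPF n v)
      rw [← Module.Dual.finrank_ker_add_one_of_ne_zero hk, Nat.succ_inj]
      conv_rhs => rw [← ih, ← hker]
      exact (Submodule.finrank_map_subtype_eq (F (n + 1)) (LinearMap.ker k)).symm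
  have htend : ∀ v, Tendsto (fun n => P n v) atTop (𝓝 v) := by
    intro v
    rw [Metric.tendsto_atTop]
    intro ε hε
    obtain ⟨w, hw, hvw⟩ := hdense.exists_dist_lt v (show 0 < ε / (C + 1) by positivity)
    obtain ⟨N, hN⟩ := Set.mem_iUnion.1 hw
    refine ⟨N, fun n hn => ?_⟩
    have h1 : P n v - v = P n (v - w) - (v - w) := by
      rw [map_sub, hPid n w (hF hn hN)]; abel
    rw [dist_eq_norm] at hvw ⊢
    calc ‖P n v - v‖ ≤ ‖P n (v - w)‖ + ‖v - w‖ := h1 ▸ norm_sub_le _ _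
      _ ≤ (C + 1) * ‖v - w‖ := by linarith [hPC n (v - w)]
      _ < (C + 1) * (ε / (C + 1)) := by gcongr
      _ = ε := by field_simp
  have he : ∀ n, ∃ v, SchauderBasis.succSub P n v ≠ 0 := by
    intro n
    obtain ⟨v, hv, hgv⟩ := hg1 n
    refine ⟨v, fun h => hgv ?_⟩
    have h : P (n + 1) v - P n v = 0 := h
    rw [hPid _ v hv, sub_eq_zero] at h
    rw [h, hg0 n _ (hPF n v)]
  choose e he using he
  let D : SchauderBasis.RankOneDecomposition 𝕜 V :=
    { P := P
      e := fun n => SchauderBasis.succSub P n (e n)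
      proj_zero := by
        ext v
        have := hPF 0 v
        rw [hF0, Submodule.mem_bot] at this
        simpa using this
      finrank_range := fun n => by rw [hrange, hrank]
      proj_comp := hcomp
      proj_tendsto := htend
      e_mem_range := fun n => ⟨e n, rfl⟩
      e_ne_zero := he }
  refine ⟨D.basis, iSup_le fun n => ?_⟩
  rw [D.basis_proj, ← ofReal_norm]
  exact ENNReal.ofReal_le_ofReal ((P n).opNorm_le_bound hC (hPC n))

/-! ### Recursive construction of the tree -/

theorem exists_tree_system {𝕜 : Type*} [RCLike 𝕜] {X : Type*} [NormedAddCommGroup X]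
    [NormedSpace 𝕜 X] [SeparableSpace X] (hX : ¬ SeparableSpace (StrongDual 𝕜 X)) {C : ℝ}
    (hC : 1 < C) :
    ∃ ε > 0, ∃ R : ℝ, ∃ (f g : ℕ → StrongDual 𝕜 X) (x : ℕ → X) (E : ℕ → Submodule 𝕜 X),
      (∀ n, ‖f n‖ ≤ R) ∧ Monotone E ∧ (∀ n, FiniteDimensional 𝕜 (E n)) ∧
      (∀ n, ∀ y ∈ E n, g n y = 0) ∧
      (∀ n, ‖g n - (f (n + 1) - f n.unpair.1)‖ ≤ (1 / 2) ^ (n + 1)) ∧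
      (∀ n, x n ∈ E (n + 1) ∧ ‖x n‖ ≤ 1 ∧ ε < ‖g n (x n)‖) ∧
      (∀ n z, ∃ y ∈ E n, (∀ i < n, g i y = g i z) ∧ ‖y‖ ≤ C * ‖z‖) ∧
      Dense (⋃ n, (E n : Set X)) := by
  obtain ⟨ε, hε, R, K, ⟨f₀, hf₀⟩, hR, hstep⟩ := exists_perturbed_difference hX
  let FD := {E : Submodule 𝕜 X // FiniteDimensional 𝕜 E}
  have hstep' : ∀ (f : K) (E : FD) (n : ℕ), ∃ (f' : K) (g : StrongDual 𝕜 X) (x : X),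
      (∀ y ∈ E.1, g y = 0) ∧ ‖g - (f'.1 - f.1)‖ ≤ (1 / 2) ^ (n + 1) ∧ ‖x‖ ≤ 1 ∧ ε < ‖g x‖ := by
    intro f E n
    obtain ⟨f', hf', g, x, h⟩ := hstep f f.2 E.1 E.2 ((1 / 2) ^ (n + 1)) (by positivity)
    exact ⟨⟨f', hf'⟩, g, x, h⟩
  choose nf ng nx hn0 hn1 hn2 hn3 using hstep'
  choose L hLfd hL using fun s : Finset (StrongDual 𝕜 X) =>
    exists_finiteDimensional_almost_isometric_lift s hC
  classical
  let step : ℕ → FD × Finset (StrongDual 𝕜 X) × (ℕ → K) →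
      FD × Finset (StrongDual 𝕜 X) × (ℕ → K) := fun n S =>
    let fp := S.2.2 n.unpair.1
    let s' := insert (ng fp S.1 n) S.2.1
    (⟨S.1.1 ⊔ Submodule.span 𝕜 {nx fp S.1 n, denseSeq X n} ⊔ L s',
      have := S.1.2
      have := hLfd s'
      have : FiniteDimensional 𝕜 (Submodule.span 𝕜 {nx fp S.1 n, denseSeq X n}) :=
        FiniteDimensional.span_of_finite 𝕜 (Set.toFinite _)
      inferInstance⟩,
      -- Only entry `n + 1` changes, and the parent `n.unpair.1 ≤ n` is already final.
      s', Function.update S.2.2 (n + 1) (nf fp S.1 n))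
  let S : ℕ → FD × Finset (StrongDual 𝕜 X) × (ℕ → K) := fun n =>
    Nat.rec (⟨⊥, inferInstance⟩, ∅, fun _ => ⟨f₀, hf₀⟩) step n
  have hS : ∀ n, S (n + 1) = step n (S n) := fun _ => rfl
  let E : ℕ → Submodule 𝕜 X := fun n => (S n).1.1
  let f : ℕ → K := fun n => (S n).2.2 n
  let g : ℕ → StrongDual 𝕜 X := fun n => ng ((S n).2.2 n.unpair.1) (S n).1 n
  have hfstable : ∀ i k, (S (i + k)).2.2 i = f i := by
    intro i k
    induction k with
    | zero => rfl
    | succ k ih =>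
      rw [← add_assoc, hS, ← ih]
      exact Function.update_of_ne (by omega) _ _
  have hfp : ∀ n, (S n).2.2 n.unpair.1 = f n.unpair.1 := fun n => by
    obtain ⟨k, hk⟩ := Nat.exists_eq_add_of_le n.unpair_left_le
    conv_lhs => rw [hk]
    rw [← hfstable n.unpair.1 k]
    rw [← hk]
  have hf : ∀ n, f (n + 1) = nf ((S n).2.2 n.unpair.1) (S n).1 n := fun n =>
    Function.update_self _ _ _
  have hE : ∀ n, E (n + 1) = E n ⊔ Submodule.span 𝕜
      {nx ((S n).2.2 n.unpair.1) (S n).1 n, denseSeq X n} ⊔ L (S (n + 1)).2.1 := fun _ => rfl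
  have hs : ∀ n, ∀ i < n, g i ∈ (S n).2.1 := by
    intro n
    induction n with
    | zero => exact fun i hi => absurd hi (Nat.not_lt_zero i)
    | succ n ih =>
      intro i hi
      rw [hS]
      rcases (Nat.lt_succ_iff_lt_or_eq).1 hi with hi | rfl
      · exact Finset.mem_insert_of_mem (ih i hi)
      · exact Finset.mem_insert_self _ _
  have hspan : ∀ n, Submodule.span 𝕜
      {nx ((S n).2.2 n.unpair.1) (S n).1 n, denseSeq X n} ≤ E (n + 1) := fun n => by
    rw [hE]; exact le_sup_right.trans le_sup_left
  refine ⟨ε, hε, R, fun n => f n, g, fun n => nx ((S n).2.2 n.unpair.1) (S n).1 n, E,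
    fun n => hR _ (f n).2, monotone_nat_of_le_succ fun n => ?_, fun n => (S n).1.2,
    fun n => hn0 _ _ _, fun n => ?_, fun n => ⟨?_, hn2 _ _ _, hn3 _ _ _⟩, fun n z => ?_, ?_⟩
  · rw [hE]; exact le_sup_left.trans le_sup_left
  · change ‖g n - ((f (n + 1)).1 - (f n.unpair.1).1)‖ ≤ _
    rw [hf, ← hfp]
    exact hn1 _ _ _
  · exact hspan n (Submodule.subset_span (Set.mem_insert _ _))
  · cases n with
    | zero => exact ⟨0, (E 0).zero_mem, fun i hi => absurd hi (Nat.not_lt_zero i), by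
        rw [norm_zero]; positivity⟩
    | succ n =>
      obtain ⟨y, hy, hyg, hyC⟩ := hL (S (n + 1)).2.1 z
      exact ⟨y, by rw [hE]; exact (le_sup_right : L (S (n + 1)).2.1 ≤ _) hy,
        fun i hi => hyg _ (hs _ i hi), hyC⟩
  · refine (denseRange_denseSeq X).mono ?_
    rintro _ ⟨n, rfl⟩
    exact Set.mem_iUnion.2 ⟨n + 1, hspan n (Submodule.subset_span
      (Set.mem_insert_of_mem _ (Set.mem_singleton _)))⟩

/-! ### Path sums and branches -/

/-- Sum of edge labels along the path to a vertex of the tree on `ℕ` in which the parent of `n + 1`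
is `n.unpair.1` and the edge between them carries `g n`. -/
def treePathSum {G : Type*} [AddMonoid G] (g : ℕ → G) : ℕ → G
  | 0 => 0
  | n + 1 => treePathSum g n.unpair.1 + g n
  decreasing_by exact Nat.lt_succ_of_le n.unpair_left_le

/-- The branch coded by `σ` in the tree on `ℕ` in which the parent of `n + 1` is `n.unpair.1`. -/
def treeBranch (σ : ℕ → ℕ) : ℕ → ℕ
  | 0 => 0
  | k + 1 => Nat.pair (treeBranch σ k) (σ k) + 1

theorem treePathSum_succ {G : Type*} [AddMonoid G] (g : ℕ → G) (n : ℕ) :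
    treePathSum g (n + 1) = treePathSum g n.unpair.1 + g n := by
  rw [treePathSum]

theorem treePathSum_treeBranch_succ {G : Type*} [AddMonoid G] (g : ℕ → G) (σ : ℕ → ℕ) (k : ℕ) :
    treePathSum g (treeBranch σ (k + 1)) =
      treePathSum g (treeBranch σ k) + g (Nat.pair (treeBranch σ k) (σ k)) := by
  rw [treeBranch, treePathSum_succ, Nat.unpair_pair]

theorem treeBranch_mono (σ : ℕ → ℕ) : Monotone (treeBranch σ) :=
  monotone_nat_of_le_succ fun _ => (Nat.left_le_pair _ _).trans (Nat.le_succ _)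

theorem treeBranch_congr {σ τ : ℕ → ℕ} {k : ℕ} (h : ∀ i < k, σ i = τ i) :
    treeBranch σ k = treeBranch τ k := by
  induction k with
  | zero => rfl
  | succ k ih =>
    rw [treeBranch, treeBranch, ih fun i hi => h i (hi.trans k.lt_succ_self), h k k.lt_succ_self]

/-- The edges on the path to `n` have distinct indices below `n`, so their errors sum to at most `∑
i < n, (1 / 2) ^ (i + 1)`. -/
theorem norm_treePathSum_sub_le {G : Type*} [NormedAddCommGroup G] {f g : ℕ → G}
    (h : ∀ n, ‖g n - (f (n + 1) - f n.unpair.1)‖ ≤ (1 / 2 : ℝ) ^ (n + 1)) (n : ℕ) :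
    ‖treePathSum g n - (f n - f 0)‖ ≤ 1 - (1 / 2 : ℝ) ^ n := by
  induction n using Nat.strong_induction_on with
  | _ n ih =>
    cases n with
    | zero => simp [treePathSum]
    | succ n =>
      have h1 := ih n.unpair.1 (Nat.lt_succ_of_le n.unpair_left_le)
      have h2 : (1 / 2 : ℝ) ^ n ≤ (1 / 2) ^ n.unpair.1 :=
        pow_le_pow_of_le_one (by norm_num) (by norm_num) n.unpair_left_le
      have h3 : treePathSum g (n + 1) - (f (n + 1) - f 0) =
          (treePathSum g n.unpair.1 - (f n.unpair.1 - f 0)) +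
            (g n - (f (n + 1) - f n.unpair.1)) := by
        rw [treePathSum_succ]; abel
      rw [h3]
      refine (norm_add_le _ _).trans ?_
      have h4 := h n
      rw [pow_succ] at h4 ⊢
      linarith

theorem uncountable_nat_to_nat : Uncountable (ℕ → ℕ) := by
  rw [← not_countable_iff]
  intro h
  obtain ⟨e, he⟩ := exists_injective_nat (ℕ → ℕ)
  exact Function.cantor_injective (fun s : Set ℕ => e (s.indicator 1))
    (he.comp fun _ _ h => Set.indicator_one_inj ℕ h)

theorem not_separableSpace_of_separated {W : Type*} [PseudoMetricSpace W] {ι : Type*}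
    [Uncountable ι] (φ : ι → W) {ε : ℝ} (hε : 0 < ε)
    (h : ∀ i j, i ≠ j → ε ≤ dist (φ i) (φ j)) : ¬ SeparableSpace W := by
  intro _
  refine not_countable (α := ι) (Pairwise.countable_of_isOpen_disjoint
    (s := fun i => ball (φ i) (ε / 2)) (fun i j hij => ?_) (fun _ => isOpen_ball)
    fun i => nonempty_ball.2 (half_pos hε))
  exact ball_disjoint_ball ((add_halves ε).trans_le (h i j hij))

/-- Banach–Alaoglu: a weak* limit along a free ultrafilter keeps eventually constant values. -/
theorem exists_strongDual_of_eventually_eq {𝕜 : Type*} [RCLike 𝕜] {X : Type*}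
    [NormedAddCommGroup X] [NormedSpace 𝕜 X] (r : ℕ → StrongDual 𝕜 X) {B : ℝ}
    (hr : ∀ n, ‖r n‖ ≤ B) :
    ∃ φ : StrongDual 𝕜 X, ∀ x c, (∀ᶠ n in atTop, r n x = c) → φ x = c := by
  obtain ⟨ψ, -, hψ⟩ := (WeakDual.isCompact_closedBall (0 : StrongDual 𝕜 X) B).ultrafilter_le_nhds
    ((hyperfilter ℕ).map fun n => StrongDual.toWeakDual (r n)) (by
      rw [Ultrafilter.coe_map, le_principal_iff, mem_map]
      exact Filter.univ_mem' fun n => mem_closedBall_zero_iff.2 (hr n))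
  refine ⟨WeakDual.toStrongDual ψ, fun x c hc => ?_⟩
  have h1 : Tendsto (fun n => r n x) (hyperfilter ℕ) (𝓝 (ψ x)) :=
    ((WeakDual.eval_continuous x).tendsto ψ).comp hψ
  have h2 : ∀ᶠ n in hyperfilter ℕ, r n x = c := Nat.hyperfilter_le_atTop hc
  exact tendsto_nhds_unique h1 (tendsto_const_nhds.congr' (h2.mono fun n hn => hn.symm))

section TreeSystem

variable {𝕜 : Type*} [RCLike 𝕜] {X : Type*} [NormedAddCommGroup X] [NormedSpace 𝕜 X]
  {g : ℕ → StrongDual 𝕜 X}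

theorem treePathSum_apply_eq_zero {x : X} (h : ∀ n, g n x = 0) (n : ℕ) :
    treePathSum g n x = 0 := by
  induction n using Nat.strong_induction_on with
  | _ n ih =>
    cases n with
    | zero => simp [treePathSum]
    | succ n =>
      rw [treePathSum_succ, add_apply, h, ih _ (Nat.lt_succ_of_le n.unpair_left_le), add_zero]

/-- Edge indices increase along a branch, so from step `k` on every label kills `E m`. -/
theorem treePathSum_treeBranch_apply_eq {E : ℕ → Submodule 𝕜 X} (hE : Monotone E)
    (hg : ∀ n, ∀ y ∈ E n, g n y = 0) {m : ℕ} {x : X} (hx : x ∈ E m) (σ : ℕ → ℕ) {k : ℕ}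
    (hk : m ≤ Nat.pair (treeBranch σ k) (σ k)) {j : ℕ} (hj : k ≤ j) :
    treePathSum g (treeBranch σ j) x = treePathSum g (treeBranch σ k) x := by
  induction j, hj using Nat.le_induction with
  | base => rfl
  | succ j hj ih =>
    rw [treePathSum_treeBranch_succ, add_apply, ih, hg _ x (hE ?_ hx), add_zero]
    rcases hj.eq_or_lt with rfl | hj
    · exact hk
    · exact hk.trans ((Nat.le_succ _).trans
        ((treeBranch_mono σ hj).trans (Nat.left_le_pair _ _)))

theorem not_separableSpace_strongDual_quotient {ε R : ℝ} (hε : 0 < ε)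
    {f : ℕ → StrongDual 𝕜 X} {x : ℕ → X} {E : ℕ → Submodule 𝕜 X} (hR : ∀ n, ‖f n‖ ≤ R)
    (hE : Monotone E) (hg : ∀ n, ∀ y ∈ E n, g n y = 0)
    (hfg : ∀ n, ‖g n - (f (n + 1) - f n.unpair.1)‖ ≤ (1 / 2) ^ (n + 1))
    (hx : ∀ n, x n ∈ E (n + 1) ∧ ‖x n‖ ≤ 1 ∧ ε < ‖g n (x n)‖)
    (Y : Submodule 𝕜 X) [IsClosed (Y : Set X)] (hY : ∀ y ∈ Y, ∀ n, g n y = 0) :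
    ¬ SeparableSpace (StrongDual 𝕜 (X ⧸ Y)) := by
  have hbound : ∀ n, ‖treePathSum g n‖ ≤ 1 + (R + R) := fun n => by
    have h1 := norm_treePathSum_sub_le hfg n
    have h2 : (0 : ℝ) ≤ (1 / 2) ^ n := by positivity
    have h3 := norm_sub_le (f n) (f 0)
    have h4 := norm_add_le (treePathSum g n - (f n - f 0)) (f n - f 0)
    rw [sub_add_cancel] at h4
    linarith [hR n, hR 0]
  choose φ hφ using fun σ => exists_strongDual_of_eventually_eq
    (fun k => treePathSum g (treeBranch σ k)) fun k => hbound _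
  have hφY : ∀ σ, Y ≤ LinearMap.ker (φ σ).toLinearMap := fun σ y hy =>
    hφ σ y 0 (Eventually.of_forall fun k => treePathSum_apply_eq_zero (hY y hy) _)
  have hval : ∀ (σ : ℕ → ℕ) (m k : ℕ) (y : X), y ∈ E m → m ≤ Nat.pair (treeBranch σ k) (σ k) →
      φ σ y = treePathSum g (treeBranch σ k) y := fun σ m k y hy hk =>
    hφ σ y _ (eventually_atTop.2 ⟨k, fun j hj => treePathSum_treeBranch_apply_eq hE hg hy σ hk hj⟩)
  let ψ : (ℕ → ℕ) → StrongDual 𝕜 (X ⧸ Y) := fun σ => Y.liftQL (φ σ) (hφY σ)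
  -- Of the two edges leaving the last common vertex, `n` is the one of smaller index. All later
  -- edges of `σ`, and the edges of `τ` from there on, have index above `n` and vanish at `x n`;
  -- only `g n (x n)` survives.
  have key : ∀ (σ τ : ℕ → ℕ) (k : ℕ), treeBranch σ k = treeBranch τ k → σ k < τ k →
      ε ≤ dist (ψ σ) (ψ τ) := by
    intro σ τ k hb hlt
    set n := Nat.pair (treeBranch σ k) (σ k) with hn
    have hσ : φ σ (x n) = treePathSum g (treeBranch σ k) (x n) + g n (x n) := by
      rw [hval σ (n + 1) (k + 1) _ (hx n).1 (Nat.left_le_pair _ _), treePathSum_treeBranch_succ]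
      rfl
    have hτ : φ τ (x n) = treePathSum g (treeBranch σ k) (x n) := by
      rw [hval τ (n + 1) k _ (hx n).1 (by rw [← hb]; exact Nat.pair_lt_pair_right _ hlt), hb]
    have h1 : (ψ σ - ψ τ) (Y.mkQ (x n)) = g n (x n) := by
      change φ σ (x n) - φ τ (x n) = _
      rw [hσ, hτ, add_sub_cancel_left]
    rw [dist_eq_norm]
    calc ε ≤ ‖(ψ σ - ψ τ) (Y.mkQ (x n))‖ := h1 ▸ (hx n).2.2.le
      _ ≤ ‖ψ σ - ψ τ‖ * ‖Y.mkQ (x n)‖ := (ψ σ - ψ τ).le_opNorm _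
      _ ≤ ‖ψ σ - ψ τ‖ * 1 := by
        gcongr
        exact (Submodule.Quotient.norm_mk_le Y (x n)).trans (hx n).2.1
      _ = ‖ψ σ - ψ τ‖ := mul_one _
  have := uncountable_nat_to_nat
  refine not_separableSpace_of_separated ψ hε fun σ τ hστ => ?_
  have hne : ∃ k, σ k ≠ τ k := Function.ne_iff.1 hστ
  classical
  have hb : treeBranch σ (Nat.find hne) = treeBranch τ (Nat.find hne) :=
    treeBranch_congr fun i hi => not_not.1 (Nat.find_min hne hi)
  rcases lt_or_gt_of_ne (Nat.find_spec hne) with h | h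
  · exact key σ τ _ hb h
  · rw [dist_comm]
    exact key τ σ _ hb.symm h

end TreeSystem

/-! ### The quotient by the common kernel -/

theorem mainTheorem3 {𝕜 : Type*} [RCLike 𝕜]
    {X : Type*} [NormedAddCommGroup X] [NormedSpace 𝕜 X] [CompleteSpace X]
    (hX : TopologicalSpace.SeparableSpace X)
    (hXdual : ¬ TopologicalSpace.SeparableSpace (StrongDual 𝕜 X))
    (δ : ℝ) (hδ : 0 < δ) :
    ∃ (Y : Submodule 𝕜 X) (_ : IsClosed (Y : Set X)),
      ¬ TopologicalSpace.SeparableSpace (StrongDual 𝕜 (X ⧸ Y)) ∧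
      ∃ b : SchauderBasis 𝕜 (X ⧸ Y), b.enormProjBound ≤ ENNReal.ofReal (1 + δ) := by
  obtain ⟨ε, hε, R, f, g, x, E, hR, hE, hEfd, hg, hfg, hx, hlift, hdense⟩ :=
    exists_tree_system hXdual (C := 1 + δ / 2) (by linarith)
  let Y : Submodule 𝕜 X := ⨅ n, LinearMap.ker (g n).toLinearMap
  have hYmem : ∀ y, y ∈ Y ↔ ∀ n, g n y = 0 := fun y => by simp [Y]
  have hYc : IsClosed (Y : Set X) := by
    rw [Submodule.coe_iInf]
    exact isClosed_iInter fun n => (g n).isClosed_ker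
  have hYker : ∀ n, Y ≤ LinearMap.ker (g n).toLinearMap := fun n => iInf_le _ n
  refine ⟨Y, hYc, not_separableSpace_strongDual_quotient hε hR hE hg hfg hx Y
    fun y hy => (hYmem y).1 hy, ?_⟩
  refine exists_schauderBasis_of_almost_isometric_lift (fun n => Y.liftQL (g n) (hYker n))
    (fun n => (E n).map Y.mkQ) (fun m n hmn => Submodule.map_mono (hE hmn)) ?_ ?_ ?_
    (by positivity) ?_ ?_
  · rintro n _ ⟨y, hy, rfl⟩
    exact hg n y hy
  · refine fun n => ⟨Y.mkQ (x n), Submodule.mem_map_of_mem (hx n).1, fun h => ?_⟩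
    have h : g n (x n) = 0 := h
    have := (hx n).2.2
    rw [h, norm_zero] at this
    exact this.not_gt hε
  · intro v hv
    obtain ⟨y, rfl⟩ := Y.mkQ_surjective v
    exact (Submodule.Quotient.mk_eq_zero Y).2 ((hYmem y).2 hv)
  · intro n v
    rcases eq_or_ne v 0 with rfl | hv
    · exact ⟨0, Submodule.zero_mem _, fun _ _ => rfl, by simp⟩
    have hv : 0 < ‖v‖ := norm_pos_iff.2 hv
    -- The slack is chosen so that `(1 + δ / 2) * (‖v‖ + slack) = (1 + δ) * ‖v‖`.
    obtain ⟨z, rfl, hz⟩ := Submodule.Quotient.norm_mk_lt v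
      (ε := ‖v‖ * (δ / 2) / (1 + δ / 2)) (by positivity)
    obtain ⟨y, hy, hyg, hyC⟩ := hlift n z
    refine ⟨Y.mkQ y, Submodule.mem_map_of_mem hy, hyg, ?_⟩
    calc ‖Y.mkQ y‖ ≤ ‖y‖ := Submodule.Quotient.norm_mk_le Y y
      _ ≤ (1 + δ / 2) * ‖z‖ := hyC
      _ ≤ (1 + δ / 2) * (_ + _) := mul_le_mul_of_nonneg_left hz.le (by positivity)
      _ = _ := by field_simp; ring
  · have := Y.mkQ_surjective.denseRange.dense_image Y.mkQL.continuous hdense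
    refine this.mono ?_
    rintro _ ⟨y, hy, rfl⟩
    obtain ⟨n, hn⟩ := Set.mem_iUnion.1 hy
    exact Set.mem_iUnion.2 ⟨n, Submodule.mem_map_of_mem hn⟩
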